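/- Let $\Omega\subseteq\mathbb R$ be a non-empty interval with its Borel $\sigma$-algebra $\mathbb B(\Omega)$, let $\mu$ be a probability measure on $\mathbb B(\Omega)$, and let $T:\Omega\to\Omega$ be a measurable map that preserves $\mu$, i.e. $\mu(T^{-1}B)=\mu(B)$ for all $B\in\mathbb B(\Omega)$. Assume that $T$ is strong-mixing: for all $A,B\in\mathbb B(\Omega)$, $$\lim_{n\to\infty}\mu(T^{-n}A\cap B)=\mu(A)\,\mu(B).$$ For $d\in\mathbb N$ let $\Pi_d$ be the set of permutations of $\{0,1,\dots,d\}$. A vector $(x_0,\dots,x_d)\in\mathbb R^{d+1}$ has the ordinal pattern $\pi=(r_0,\dots,r_d)\in\Pi_d$ if $x_{r_0}\ge x_{r_1}\ge\dots\ge x_{r_d}$ and $r_{l-1}>r_l$ whenever $x_{r_{l-1}}=x_{r_l}$. For $\pi\in\Pi_d$ let $P_\pi$ be the set of all $\omega\in\Omega$ such that $(T^{d}\omega,T^{d-1}\omega,\dots,T\omega,\omega)$ has the ordinal pattern $\pi$, and let $\mathcal P(d)=\{P_\pi : \pi\in\Pi_d\}$ be the ordinal partition of order $d$ with respect to $T$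 and the observable $\mathbf X=\mathrm{id}$. Let $\mathcal P(d)_2=\{P_\pi\cap T^{-1}(P_\xi) : \pi,\xi\in\Pi_d\}$. For a finite measurable partition $\mathcal P$ let $H(\mathcal P)=-\sum_{P\in\mathcal P}\mu(P)\ln\mu(P)$, with $0\ln 0:=0$, be its Shannon entropy. Define the sorting entropy and the conditional entropy of ordinal patterns of order $d$ by $$h_{\mu,\triangle}^{\mathrm{id}}(T,d)=H(\mathcal P(d+1))-H(\mathcal P(d)),\qquad h_{\mu,\mathrm{cond}}^{\mathrm{id}}(T,d)=H(\mathcal P(d)_2)-H(\mathcal P(d)).$$ Then $$\lim_{d\to\infty}\left(h_{\mu,\triangle}^{\mathrm{id}}(T,d)-h_{\mu,\mathrm{cond}}^{\mathrm{id}}(T,d)\right)=0.$$ -/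

import Mathlib

open Filter Topology MeasureTheory

noncomputable section

namespace OrdinalEntropy

/-- `T` is strong-mixing: `μ (T^{-n} A ∩ B) → μ A * μ B` for all measurable `A`, `B`. -/
def StrongMixing {Ω : Type*} [MeasurableSpace Ω] (T : Ω → Ω) (μ : Measure Ω) : Prop :=
  ∀ A B : Set Ω, MeasurableSet A → MeasurableSet B →
    Tendsto (fun n : ℕ => μ (T^[n] ⁻¹' A ∩ B)) atTop (𝓝 (μ A * μ B))

/-- Shannon entropy (natural logarithm, `0 ln 0 = 0`) of a finite partition given as an indexed
family; empty members of the family contribute `0`. -/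
def shannonEntropy {Ω ι : Type*} [MeasurableSpace Ω] [Fintype ι] (μ : Measure Ω)
    (P : ι → Set Ω) : ℝ :=
  -∑ a, μ.real (P a) * Real.log (μ.real (P a))

/-- The partition `P_n`: its element for the word `a_0 a_1 … a_{n-1}` is
`P_{a_0} ∩ T^{-1} P_{a_1} ∩ … ∩ T^{-(n-1)} P_{a_{n-1}}`. -/
def wordPartition {Ω ι : Type*} (T : Ω → Ω) (P : ι → Set Ω) (n : ℕ) : (Fin n → ι) → Set Ω :=
  fun a => ⋂ k : Fin n, T^[(k : ℕ)] ⁻¹' P (a k)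

/-- The vector `x = (x_0, …, x_d)` has the ordinal pattern `π = (r_0, …, r_d)`, `r_l = π l`:
`x_{r_0} ≥ x_{r_1} ≥ … ≥ x_{r_d}`, and `r_{l-1} > r_l` whenever `x_{r_{l-1}} = x_{r_l}`. -/
def HasOrdinalPattern {d : ℕ} (x : Fin (d + 1) → ℝ) (π : Equiv.Perm (Fin (d + 1))) : Prop :=
  ∀ l : Fin d, x (π l.castSucc) ≥ x (π l.succ) ∧
    (x (π l.castSucc) = x (π l.succ) → π l.castSucc > π l.succ)

/-- The ordinal partition of order `d` with respect to `T` and `X = (X_1, …, X_N)`: the element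
for `(π_1, …, π_N)` is the set of `ω` such that, for each `i`, the vector
`(X_i (T^d ω), X_i (T^{d-1} ω), …, X_i (T ω), X_i ω)` has the ordinal pattern `π_i`. -/
def ordinalPartition {Ω : Type*} {N : ℕ} (T : Ω → Ω) (X : Fin N → Ω → ℝ) (d : ℕ) :
    (Fin N → Equiv.Perm (Fin (d + 1))) → Set Ω :=
  fun π => {ω | ∀ i : Fin N,
    HasOrdinalPattern (fun j : Fin (d + 1) => X i (T^[d - (j : ℕ)] ω)) (π i)}

/-- The sorting entropy of order `d`. -/
def sortingEntropy {Ω : Type*} [MeasurableSpace Ω] {N : ℕ} (μ : Measure Ω) (T : Ω → Ω)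
    (X : Fin N → Ω → ℝ) (d : ℕ) : ℝ :=
  shannonEntropy μ (ordinalPartition T X (d + 1)) - shannonEntropy μ (ordinalPartition T X d)

/-- The conditional entropy of ordinal patterns of order `d`. -/
def conditionalEntropy {Ω : Type*} [MeasurableSpace Ω] {N : ℕ} (μ : Measure Ω) (T : Ω → Ω)
    (X : Fin N → Ω → ℝ) (d : ℕ) : ℝ :=
  shannonEntropy μ (wordPartition T (ordinalPartition T X d) 2) -
    shannonEntropy μ (ordinalPartition T X d)

/-- The observable `X = id` on a subset of the real line, as a one-component random vector. -/
def idObservable (S : Set ℝ) : Fin 1 → S → ℝ := fun _ ω => (ω : ℝ)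

end OrdinalEntropy

end

/-!
The order of the `d + 2` points `ω, T ω, …, T^{d+1} ω` is determined by the ordinal patterns of
order `d` of `ω` and of `T ω`, except for the comparison of `ω` with `T^{d+1} ω`. Hence the ordinal
partition of order `d + 1` refines the word partition of length two by splitting each cell into at
most two pieces. A cell is not split at all as soon as it contains a point `ω` for which some
intermediate iterate lies strictly between `ω` and `T^{d+1} ω`, since then the comparison follows by
transitivity. So the difference of the two entropies is nonnegative and at most `log 2` times the
measure of `neighbourSet`, the set where no such iterate exists
(`sortingEntropy_sub_conditionalEntropy_bounds`, resting on `shannonEntropy_refinement`).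

It remains to see that `neighbourSet` becomes small. Under strong mixing, an atom carries the whole
measure, and then all entropies vanish. In the atomless case the line is cut by the distribution
function into `m` consecutive bins of measure `1 / m`. If `ω` and `T^{d+1} ω` lie in bins that are
not adjacent, a bin lies strictly between them, and the orbit avoids that bin up to time `d` only
with a probability tending to zero. That they lie in equal or adjacent bins has, by mixing, an
asymptotic probability of at most `3 / m`
(`StrongMixing.tendsto_measureReal_neighbourSet`).
-/

noncomputable section

open Filter Topology MeasureTheory

namespace OrdinalEntropy

/-! ### Entropy of a refinement with at most two pieces per cell -/

/-- A family of measurable sets such that every point lies in exactly one member. Members may be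
empty. -/
def IsMeasurablePartition {Ω ι : Type*} [MeasurableSpace Ω] (P : ι → Set Ω) : Prop :=
  (∀ a, MeasurableSet (P a)) ∧ ∀ ω, ∃! a, ω ∈ P a

lemma IsMeasurablePartition.sum_measureReal_inter {Ω ι : Type*} [MeasurableSpace Ω] [Fintype ι]
    {μ : Measure Ω} [IsFiniteMeasure μ] {P : ι → Set Ω} (hP : IsMeasurablePartition P)
    {S : Set Ω} (hS : MeasurableSet S) : ∑ a, μ.real (P a ∩ S) = μ.real S := by
  rw [← measureReal_iUnion_fintype]
  · congr 1
    ext ω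
    obtain ⟨a, ha, -⟩ := hP.2 ω
    simp only [Set.mem_iUnion, Set.mem_inter_iff]
    exact ⟨fun ⟨_, h⟩ => h.2, fun h => ⟨a, ha, h⟩⟩
  · intro a b hab
    refine Set.disjoint_left.2 fun ω ha hb => hab ((hP.2 ω).unique ha.1 hb.1)
  · exact fun a => (hP.1 a).inter hS

lemma shannonEntropy_eq_sum_negMulLog {Ω ι : Type*} [MeasurableSpace Ω] [Fintype ι]
    (μ : Measure Ω) (P : ι → Set Ω) :
    shannonEntropy μ P = ∑ a, Real.negMulLog (μ.real (P a)) := by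
  simp [shannonEntropy, Real.negMulLog]

lemma negMulLog_sum_le {ι : Type*} (s : Finset ι) (p : ι → ℝ) (hp : ∀ i ∈ s, 0 ≤ p i) :
    Real.negMulLog (∑ i ∈ s, p i) ≤ ∑ i ∈ s, Real.negMulLog (p i) := by
  have key : ∀ i ∈ s, p i * Real.log (p i) ≤ p i * Real.log (∑ i ∈ s, p i) := by
    intro i hi
    rcases (hp i hi).eq_or_lt with h | h
    · simp [← h]
    · exact mul_le_mul_of_nonneg_left
        (Real.log_le_log h (Finset.single_le_sum hp hi)) h.le
  have := Finset.sum_le_sum key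
  rw [← Finset.sum_mul] at this
  simp only [Real.negMulLog, neg_mul, Finset.sum_neg_distrib]
  linarith

/-- The entropy gained by splitting a mass into `n` pieces is at most `log n` times the mass. -/
lemma sum_negMulLog_le {ι : Type*} (s : Finset ι) (p : ι → ℝ) (hp : ∀ i ∈ s, 0 ≤ p i) :
    ∑ i ∈ s, Real.negMulLog (p i) ≤
      Real.negMulLog (∑ i ∈ s, p i) + (∑ i ∈ s, p i) * Real.log s.card := by
  rcases s.eq_empty_or_nonempty with rfl | hs
  · simp
  have hN : (0 : ℝ) < s.card := by exact_mod_cast hs.card_pos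
  have hJ := Real.concaveOn_negMulLog.le_map_sum (t := s) (w := fun _ => (s.card : ℝ)⁻¹) (p := p)
    (fun _ _ => by positivity) (by simp [hN.ne']) hp
  simp only [smul_eq_mul, ← Finset.mul_sum] at hJ
  have hle : ∑ i ∈ s, Real.negMulLog (p i) ≤
      s.card * Real.negMulLog ((s.card : ℝ)⁻¹ * ∑ i ∈ s, p i) := by
    rwa [inv_mul_le_iff₀ hN] at hJ
  refine hle.trans (le_of_eq ?_)
  rw [Real.negMulLog_mul]
  simp only [Real.negMulLog, Real.log_inv]
  field_simp
  ring

/-- If `P` refines `Q`, splits each cell of `Q` into at most two pieces according to the truth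
value of `b`, and splits only cells of `Q` lying in `V`, then passing from `Q` to `P` gains at
most `log 2 * μ V` of entropy. -/
lemma shannonEntropy_refinement {Ω ι κ : Type*} [MeasurableSpace Ω] [Fintype ι] [Fintype κ]
    {μ : Measure Ω} [IsFiniteMeasure μ] {P : ι → Set Ω} {Q : κ → Set Ω}
    (hP : IsMeasurablePartition P) (hQ : IsMeasurablePartition Q) (b : Ω → Prop) (V : Set Ω)
    (hPQ : ∀ a q, ∀ ω ∈ P a, ∀ ω' ∈ P a, ω ∈ Q q → ω' ∈ Q q)
    (hb : ∀ a q, ∀ ω ∈ Q q, ∀ ω' ∈ Q q, (b ω ↔ b ω') → ω ∈ P a → ω' ∈ P a)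
    (hV : ∀ q, ∀ ω ∈ Q q, ω ∉ V → ∀ ω' ∈ Q q, (b ω ↔ b ω')) :
    0 ≤ shannonEntropy μ P - shannonEntropy μ Q ∧
      shannonEntropy μ P - shannonEntropy μ Q ≤ Real.log 2 * μ.real V := by
  classical
  rw [shannonEntropy_eq_sum_negMulLog, shannonEntropy_eq_sum_negMulLog]
  -- A piece `P a` lies in a single cell of `Q`, so its other intersections contribute `0`.
  have hsplit : ∑ a, Real.negMulLog (μ.real (P a)) =
      ∑ q, ∑ a, Real.negMulLog (μ.real (P a ∩ Q q)) := by
    rw [Finset.sum_comm]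
    refine Finset.sum_congr rfl fun a _ => ?_
    rcases (P a).eq_empty_or_nonempty with h | ⟨ω, hω⟩
    · simp [h]
    obtain ⟨q, hq, hq'⟩ := hQ.2 ω
    rw [Finset.sum_eq_single q]
    · rw [Set.inter_eq_left.2 fun ω' hω' => hPQ a q ω hω ω' hω' hq]
    · intro r _ hr
      have : P a ∩ Q r = ∅ := by
        ext ω'
        simp only [Set.mem_inter_iff, Set.mem_empty_iff_false, iff_false, not_and]
        exact fun h1 h2 => hr (hq' r (hPQ a r ω' h1 ω hω h2))
      simp [this]
    · simp
  rw [hsplit, ← Finset.sum_sub_distrib]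
  have hlow : ∀ q, 0 ≤ ∑ a, Real.negMulLog (μ.real (P a ∩ Q q)) -
      Real.negMulLog (μ.real (Q q)) := by
    intro q
    rw [sub_nonneg, ← hP.sum_measureReal_inter (hQ.1 q)]
    exact negMulLog_sum_le _ _ fun _ _ => measureReal_nonneg
  have hup : ∀ q, ∑ a, Real.negMulLog (μ.real (P a ∩ Q q)) - Real.negMulLog (μ.real (Q q)) ≤
      if Q q ⊆ V then Real.log 2 * μ.real (Q q) else 0 := by
    intro q
    set s : Finset ι := Finset.univ.filter fun a => (P a ∩ Q q).Nonempty with hs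
    have hne : ∀ a, a ∉ s → μ.real (P a ∩ Q q) = 0 := by
      intro a ha
      have : P a ∩ Q q = ∅ := by
        simpa [hs, Set.not_nonempty_iff_eq_empty] using ha
      simp [this]
    have h1 : ∑ a, Real.negMulLog (μ.real (P a ∩ Q q)) =
        ∑ a ∈ s, Real.negMulLog (μ.real (P a ∩ Q q)) :=
      (Finset.sum_subset (Finset.subset_univ s) fun a _ ha => by simp [hne a ha]).symm
    have h2 : ∑ a ∈ s, μ.real (P a ∩ Q q) = μ.real (Q q) := by
      rw [← hP.sum_measureReal_inter (hQ.1 q)]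
      exact Finset.sum_subset (Finset.subset_univ s) fun a _ ha => hne a ha
    have h3 := sum_negMulLog_le s (fun a => μ.real (P a ∩ Q q)) fun _ _ => measureReal_nonneg
    rw [← h1, h2] at h3
    have hmem : ∀ a : s, (P a ∩ Q q).Nonempty := fun a => (Finset.mem_filter.1 a.2).2
    choose w hw using hmem
    -- Distinct pieces of one cell are told apart by the truth value of `b`.
    have hinj : ∀ a a' : s, (b (w a) ↔ b (w a')) → a = a' := by
      intro a a' h
      exact Subtype.ext ((hP.2 (w a')).unique
        (hb a q _ (hw a).2 _ (hw a').2 h (hw a).1) (hw a').1)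
    split_ifs with hqV
    · have hcard : s.card ≤ 2 := by
        have : Function.Injective fun a : s => decide (b (w a)) :=
          fun a a' h => hinj a a' (by simpa using h)
        simpa using Fintype.card_le_of_injective _ this
      have hlog : Real.log s.card ≤ Real.log 2 := by
        rcases Nat.eq_zero_or_pos s.card with h | h
        · rw [h]; simpa using Real.log_nonneg (by norm_num : (1 : ℝ) ≤ 2)
        · exact Real.log_le_log (by exact_mod_cast h) (by exact_mod_cast hcard)
      have := mul_le_mul_of_nonneg_left hlog (measureReal_nonneg (μ := μ) (s := Q q))
      linarith
    · obtain ⟨ω, hω, hωV⟩ := Set.not_subset.1 hqV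
      have hcard : s.card ≤ 1 := Finset.card_le_one.2 fun a ha a' ha' => by
        have := hinj ⟨a, ha⟩ ⟨a', ha'⟩
          ((hV q ω hω hωV _ (hw _).2).symm.trans (hV q ω hω hωV _ (hw _).2))
        exact congrArg Subtype.val this
      have hlog : Real.log s.card = 0 := by
        interval_cases s.card <;> simp
      rw [hlog] at h3
      linarith
  refine ⟨Finset.sum_nonneg fun q _ => hlow q, (Finset.sum_le_sum fun q _ => hup q).trans ?_⟩
  rw [← Finset.sum_filter, ← Finset.mul_sum, ← measureReal_biUnion_finset]
  · refine mul_le_mul_of_nonneg_left (measureReal_mono ?_) (Real.log_nonneg (by norm_num))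
    simp
  · intro q _ r _ hqr
    exact Set.disjoint_left.2 fun ω h h' => hqr ((hQ.2 ω).unique h h')
  · exact fun q _ => hQ.1 q

/-! ### Ordinal patterns as orders -/

/-- The position `i` tagged with its value `x i` and ordered lexicographically; an ordinal pattern
lists the positions in decreasing order of their keys. -/
def patternKey {n : ℕ} (x : Fin n → ℝ) (i : Fin n) : ℝ ×ₗ Fin n := toLex (x i, i)

lemma patternKey_injective {n : ℕ} (x : Fin n → ℝ) : Function.Injective (patternKey x) :=
  fun _ _ h => (Prod.ext_iff.1 (toLex.injective h)).2

lemma patternKey_lt_iff {n : ℕ} (x : Fin n → ℝ) (i j : Fin n) :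
    patternKey x i < patternKey x j ↔ x i < x j ∨ x i = x j ∧ i < j := by
  simp [patternKey, Prod.Lex.toLex_lt_toLex]

lemma hasOrdinalPattern_iff_strictAnti {d : ℕ} {x : Fin (d + 1) → ℝ}
    {π : Equiv.Perm (Fin (d + 1))} :
    HasOrdinalPattern x π ↔ StrictAnti (patternKey x ∘ π) := by
  rw [Fin.strictAnti_iff_succ_lt]
  refine forall_congr' fun l => ?_
  simp only [Function.comp_apply, patternKey_lt_iff, ge_iff_le, gt_iff_lt]
  constructor
  · rintro ⟨h1, h2⟩
    rcases h1.lt_or_eq with h | h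
    · exact Or.inl h
    · exact Or.inr ⟨h, h2 h.symm⟩
  · rintro (h | ⟨h, h'⟩)
    · exact ⟨h.le, fun e => absurd e h.ne'⟩
    · exact ⟨h.le, fun _ => h'⟩

lemma existsUnique_hasOrdinalPattern {d : ℕ} (x : Fin (d + 1) → ℝ) :
    ∃! π, HasOrdinalPattern x π := by
  simp only [hasOrdinalPattern_iff_strictAnti]
  refine ⟨Fin.revPerm.trans (Tuple.sort (patternKey x)), ?_, fun σ hσ => ?_⟩
  · refine Antitone.strictAnti_of_injective ?_
      ((patternKey_injective x).comp (Equiv.injective _))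
    intro i j hij
    exact Tuple.monotone_sort (patternKey x) (Fin.rev_le_rev.2 hij)
  · refine Equiv.ext fun i => patternKey_injective x ?_
    refine congrFun (Tuple.unique_antitone hσ.antitone ?_) i
    intro i j hij
    exact Tuple.monotone_sort (patternKey x) (Fin.rev_le_rev.2 hij)

/-- Two vectors share their ordinal pattern exactly when they order the positions in the same
way. -/
lemma HasOrdinalPattern.iff_patternKey_lt {d : ℕ} {x y : Fin (d + 1) → ℝ}
    {π : Equiv.Perm (Fin (d + 1))} (h : HasOrdinalPattern x π) :
    HasOrdinalPattern y π ↔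
      ∀ i j, patternKey x i < patternKey x j ↔ patternKey y i < patternKey y j := by
  rw [hasOrdinalPattern_iff_strictAnti] at h ⊢
  constructor
  · intro h' i j
    obtain ⟨i, rfl⟩ := π.surjective i
    obtain ⟨j, rfl⟩ := π.surjective j
    exact (h.lt_iff_gt (a := i) (b := j)).trans (h'.lt_iff_gt (a := i) (b := j)).symm
  · intro H i j hij
    exact (H _ _).1 (h hij)

variable {Ω : Type*}

/-- The orbit segment `(X (T^d ω), …, X (T ω), X ω)` whose ordinal pattern is considered. -/
def orbitVec (T : Ω → Ω) (X : Ω → ℝ) (d : ℕ) (ω : Ω) (j : Fin (d + 1)) : ℝ :=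
  X (T^[d - (j : ℕ)] ω)

lemma orbitVec_succ (T : Ω → Ω) (X : Ω → ℝ) (d : ℕ) (ω : Ω) (j : Fin (d + 1)) :
    orbitVec T X (d + 1) ω j.succ = orbitVec T X d ω j := by
  simp [orbitVec]

lemma orbitVec_castSucc (T : Ω → Ω) (X : Ω → ℝ) (d : ℕ) (ω : Ω) (j : Fin (d + 1)) :
    orbitVec T X (d + 1) ω j.castSucc = orbitVec T X d (T ω) j := by
  have : d + 1 - (j : ℕ) = (d - j) + 1 := by have := j.2; omega
  simp [orbitVec, this]

lemma patternKey_orbitVec_succ (T : Ω → Ω) (X : Ω → ℝ) (d : ℕ) (ω : Ω) (i j : Fin (d + 1)) :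
    patternKey (orbitVec T X (d + 1) ω) i.succ < patternKey (orbitVec T X (d + 1) ω) j.succ ↔
      patternKey (orbitVec T X d ω) i < patternKey (orbitVec T X d ω) j := by
  simp [patternKey_lt_iff, orbitVec_succ]

lemma patternKey_orbitVec_castSucc (T : Ω → Ω) (X : Ω → ℝ) (d : ℕ) (ω : Ω) (i j : Fin (d + 1)) :
    patternKey (orbitVec T X (d + 1) ω) i.castSucc <
        patternKey (orbitVec T X (d + 1) ω) j.castSucc ↔
      patternKey (orbitVec T X d (T ω)) i < patternKey (orbitVec T X d (T ω)) j := by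
  simp [patternKey_lt_iff, orbitVec_castSucc]

lemma mem_ordinalPartition_iff (T : Ω → Ω) (X : Fin 1 → Ω → ℝ) (d : ℕ)
    (π : Fin 1 → Equiv.Perm (Fin (d + 1))) (ω : Ω) :
    ω ∈ ordinalPartition T X d π ↔ HasOrdinalPattern (orbitVec T (X 0) d ω) (π 0) := by
  simp only [ordinalPartition, Set.mem_ofPred_eq, Fin.forall_fin_one]
  rfl

lemma isMeasurablePartition_ordinalPartition [MeasurableSpace Ω] {T : Ω → Ω}
    (hT : Measurable T) {X : Fin 1 → Ω → ℝ} (hX : Measurable (X 0)) (d : ℕ) :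
    IsMeasurablePartition (ordinalPartition T X d) := by
  constructor
  · intro π
    have hm : ∀ j, Measurable fun ω => orbitVec T (X 0) d ω j :=
      fun j => hX.comp (hT.iterate _)
    have : ordinalPartition T X d π = ⋂ l : Fin d,
        {ω | orbitVec T (X 0) d ω (π 0 l.succ) ≤ orbitVec T (X 0) d ω (π 0 l.castSucc)} ∩
        ({ω | orbitVec T (X 0) d ω (π 0 l.castSucc) = orbitVec T (X 0) d ω (π 0 l.succ)}ᶜ ∪
          {_ω | π 0 l.castSucc > π 0 l.succ}) := by
      ext ω
      simp [mem_ordinalPartition_iff, HasOrdinalPattern, imp_iff_not_or]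
    rw [this]
    exact MeasurableSet.iInter fun l => (measurableSet_le (hm _) (hm _)).inter
      ((measurableSet_eq_fun (hm _) (hm _)).compl.union (MeasurableSet.const _))
  · intro ω
    obtain ⟨π, hπ, hu⟩ := existsUnique_hasOrdinalPattern (orbitVec T (X 0) d ω)
    refine ⟨fun _ => π, (mem_ordinalPartition_iff ..).2 hπ, fun σ hσ => ?_⟩
    ext1 i
    rw [Subsingleton.elim i 0]
    exact hu _ ((mem_ordinalPartition_iff ..).1 hσ)

lemma mem_wordPartition_two {ι : Type*} (T : Ω → Ω) (P : ι → Set Ω) (a : Fin 2 → ι) (ω : Ω) :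
    ω ∈ wordPartition T P 2 a ↔ ω ∈ P (a 0) ∧ T ω ∈ P (a 1) := by
  simp [wordPartition, Fin.forall_fin_two]

lemma IsMeasurablePartition.wordPartition_two {ι : Type*} [MeasurableSpace Ω] {T : Ω → Ω}
    (hT : Measurable T) {P : ι → Set Ω} (hP : IsMeasurablePartition P) :
    IsMeasurablePartition (wordPartition T P 2) := by
  constructor
  · exact fun a => MeasurableSet.iInter fun k => hT.iterate _ (hP.1 _)
  · intro ω
    obtain ⟨a, ha, hua⟩ := hP.2 ω
    obtain ⟨b, hb, hub⟩ := hP.2 (T ω)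
    refine ⟨![a, b], (mem_wordPartition_two ..).2 ⟨ha, hb⟩, fun c hc => ?_⟩
    have hc := (mem_wordPartition_two ..).1 hc
    ext1 i
    fin_cases i
    · exact hua _ hc.1
    · exact hub _ hc.2

/-- The points `ω` for which none of `T ω, …, T^d ω` has its value strictly between those of `ω`
and `T^{d+1} ω`. -/
def neighbourSet (T : Ω → Ω) (X : Ω → ℝ) (d : ℕ) : Set Ω :=
  {ω | ∀ i, 1 ≤ i → i ≤ d →
    ¬ (X ω < X (T^[i] ω) ∧ X (T^[i] ω) < X (T^[d + 1] ω)) ∧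
    ¬ (X (T^[d + 1] ω) < X (T^[i] ω) ∧ X (T^[i] ω) < X ω)}

/-- The difference of the two entropies is the entropy gained when the patterns of `ω` and `T ω`
are refined by comparing `ω` with `T^{d+1} ω`. This comparison is already decided as soon as an
intermediate iterate separates the two points. -/
lemma sortingEntropy_sub_conditionalEntropy_bounds [MeasurableSpace Ω] {μ : Measure Ω}
    [IsFiniteMeasure μ] {T : Ω → Ω} (hT : Measurable T) {X : Fin 1 → Ω → ℝ}
    (hX : Measurable (X 0)) (d : ℕ) :
    0 ≤ sortingEntropy μ T X d - conditionalEntropy μ T X d ∧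
      sortingEntropy μ T X d - conditionalEntropy μ T X d ≤
        Real.log 2 * μ.real (neighbourSet T (X 0) d) := by
  have hP := isMeasurablePartition_ordinalPartition hT hX
  have hdiff : sortingEntropy μ T X d - conditionalEntropy μ T X d =
      shannonEntropy μ (ordinalPartition T X (d + 1)) -
        shannonEntropy μ (wordPartition T (ordinalPartition T X d) 2) := by
    simp only [sortingEntropy, conditionalEntropy]
    ring
  rw [hdiff]
  set K : Ω → Fin (d + 2) → ℝ ×ₗ Fin (d + 2) := fun ω => patternKey (orbitVec T (X 0) (d + 1) ω)
    with hK
  have hKinj : ∀ ω, Function.Injective (K ω) := fun ω => patternKey_injective _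
  -- A cell of the word partition determines the order of all pairs of positions except `(0, d+1)`.
  have hQ : ∀ q, ∀ ω ∈ wordPartition T (ordinalPartition T X d) 2 q,
      ∀ ω', ω' ∈ wordPartition T (ordinalPartition T X d) 2 q ↔
        (∀ i j : Fin (d + 1), K ω i.succ < K ω j.succ ↔ K ω' i.succ < K ω' j.succ) ∧
        (∀ i j : Fin (d + 1),
          K ω i.castSucc < K ω j.castSucc ↔ K ω' i.castSucc < K ω' j.castSucc) := by
    intro q ω hω ω'
    simp only [mem_wordPartition_two, mem_ordinalPartition_iff] at hω
    simp only [mem_wordPartition_two, mem_ordinalPartition_iff, hK, patternKey_orbitVec_succ,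
      patternKey_orbitVec_castSucc, hω.1.iff_patternKey_lt, hω.2.iff_patternKey_lt]
  have hPK : ∀ a, ∀ ω ∈ ordinalPartition T X (d + 1) a,
      ∀ ω', ω' ∈ ordinalPartition T X (d + 1) a ↔ ∀ i j, K ω i < K ω j ↔ K ω' i < K ω' j := by
    intro a ω hω ω'
    rw [mem_ordinalPartition_iff] at hω
    rw [mem_ordinalPartition_iff, hω.iff_patternKey_lt]
  refine shannonEntropy_refinement (hP (d + 1)) ((hP d).wordPartition_two hT)
    (fun ω => K ω 0 < K ω (Fin.last (d + 1))) _ ?_ ?_ ?_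
  · intro a q ω hω ω' hω' hq
    have h := (hPK a ω hω ω').1 hω'
    exact (hQ q ω hq ω').2 ⟨fun i j => h _ _, fun i j => h _ _⟩
  · intro a q ω hω ω' hω' hb ha
    have h := (hQ q ω hω ω').1 hω'
    refine (hPK a ω ha ω').2 fun i j => ?_
    have hflip : ∀ ω, K ω (Fin.last (d + 1)) < K ω 0 ↔ ¬ K ω 0 < K ω (Fin.last (d + 1)) := by
      intro ω
      have : K ω (Fin.last (d + 1)) ≠ K ω 0 := fun e => by
        simpa using hKinj ω e
      rw [not_lt]
      exact ⟨le_of_lt, fun h => lt_of_le_of_ne h this⟩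
    rcases Fin.eq_zero_or_eq_succ i with rfl | ⟨i, rfl⟩
    · rcases Fin.eq_castSucc_or_eq_last j with ⟨j, rfl⟩ | rfl
      · exact h.2 0 j
      · exact hb
    · rcases Fin.eq_zero_or_eq_succ j with rfl | ⟨j, rfl⟩
      · rcases Fin.eq_castSucc_or_eq_last i.succ with ⟨i', hi'⟩ | hi'
        · rw [hi']
          exact h.2 i' 0
        · rw [hi', hflip, hflip, not_iff_not]
          exact hb
      · exact h.1 i j
  · intro q ω hω hV ω' hω'
    have h := (hQ q ω hω ω').1 hω'
    -- Position `k` carries the iterate `T^{d+1-k}`, so the separating iterate is at `k+1`.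
    simp only [neighbourSet, Set.mem_ofPred_eq, not_forall] at hV
    obtain ⟨i, hi1, hid, hi⟩ := hV
    obtain ⟨k, hkd, e1⟩ : ∃ k : ℕ, k < d ∧ d + 1 - (k + 1) = i :=
      ⟨d - i, by omega, by omega⟩
    -- Position `k+1` is compared with `d+1` through the pattern of `ω`, where it is a `succ`, and
    -- with `0` through the pattern of `T ω`, where it is a `castSucc`.
    have hcast : (⟨k, by omega⟩ : Fin (d + 1)).succ =
        (⟨k + 1, by omega⟩ : Fin (d + 1)).castSucc := rfl
    have hv0 : orbitVec T (X 0) (d + 1) ω 0 = X 0 (T^[d + 1] ω) := by simp [orbitVec]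
    have hvl : orbitVec T (X 0) (d + 1) ω (Fin.last (d + 1)) = X 0 ω := by simp [orbitVec]
    have hvk : orbitVec T (X 0) (d + 1) ω (⟨k, by omega⟩ : Fin (d + 1)).succ =
        X 0 (T^[i] ω) := by
      simp only [orbitVec, Fin.val_succ]
      rw [e1]
    have t1 : ∀ {i j}, orbitVec T (X 0) (d + 1) ω i < orbitVec T (X 0) (d + 1) ω j →
        K ω i < K ω j := fun h => (patternKey_lt_iff _ _ _).2 (Or.inl h)
    rw [not_and_or, not_not, not_not, ← hv0, ← hvl, ← hvk] at hi
    rcases hi with ⟨ha, hb⟩ | ⟨ha, hb⟩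
    · have ha' := (h.1 (Fin.last d) _).1 (t1 ha)
      have hb' := t1 hb
      rw [hcast] at hb'
      have hb' := (h.2 _ 0).1 hb'
      exact iff_of_false (not_lt.2 ((t1 ha).trans (t1 hb)).le) (not_lt.2 (ha'.trans hb').le)
    · have hb' := (h.1 _ (Fin.last d)).1 (t1 hb)
      have ha' := t1 ha
      rw [hcast] at ha'
      have ha' := (h.2 0 _).1 ha'
      exact iff_of_true ((t1 ha).trans (t1 hb)) (ha'.trans hb')

/-! ### Consequences of strong mixing -/

lemma StrongMixing.tendsto_measureReal {Ω : Type*} [MeasurableSpace Ω] {μ : Measure Ω}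
    [IsFiniteMeasure μ] {T : Ω → Ω} (hmix : StrongMixing T μ) {A B : Set Ω}
    (hA : MeasurableSet A) (hB : MeasurableSet B) :
    Tendsto (fun n : ℕ => μ.real (T^[n] ⁻¹' A ∩ B)) atTop (𝓝 (μ.real A * μ.real B)) := by
  have := (ENNReal.tendsto_toReal
    (ENNReal.mul_ne_top (measure_ne_top μ A) (measure_ne_top μ B))).comp (hmix A B hA hB)
  rwa [ENNReal.toReal_mul] at this

/-- Almost every orbit visits a set of positive measure, so the points that avoid it for a long
time form a set of small measure. -/
lemma StrongMixing.tendsto_measureReal_avoid {Ω : Type*} [MeasurableSpace Ω] {μ : Measure Ω}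
    [IsFiniteMeasure μ] {T : Ω → Ω} (hT : Measurable T) (hmix : StrongMixing T μ) {B : Set Ω}
    (hB : MeasurableSet B) (hpos : μ.real B ≠ 0) :
    Tendsto (fun d : ℕ => μ.real {ω | ∀ i, 1 ≤ i → i ≤ d → T^[i] ω ∉ B}) atTop (𝓝 0) := by
  set N : ℕ → Set Ω := fun d => {ω | ∀ i, 1 ≤ i → i ≤ d → T^[i] ω ∉ B} with hN
  have hNm : ∀ d, MeasurableSet (N d) := by
    intro d
    simp only [hN, Set.ofPred_forall]
    exact MeasurableSet.iInter fun i => MeasurableSet.iInter fun _ => MeasurableSet.iInter fun _ =>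
      hT.iterate i hB.compl
  have hE : MeasurableSet (⋂ d, N d) := MeasurableSet.iInter hNm
  have hzero : μ.real (⋂ d, N d) = 0 := by
    have h1 := hmix.tendsto_measureReal hB hE
    have h2 : Tendsto (fun n : ℕ => μ.real (T^[n] ⁻¹' B ∩ ⋂ d, N d)) atTop (𝓝 0) := by
      refine tendsto_const_nhds.congr' ?_
      filter_upwards [eventually_ge_atTop 1] with n hn
      have : T^[n] ⁻¹' B ∩ ⋂ d, N d = ∅ := by
        ext ω
        simp only [Set.mem_inter_iff, Set.mem_preimage, Set.mem_iInter, Set.mem_empty_iff_false,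
          iff_false, not_and]
        exact fun h h' => h' n n hn le_rfl h
      simp [this]
    exact (mul_eq_zero.1 (tendsto_nhds_unique h1 h2)).resolve_left hpos
  have hlim := tendsto_measure_iInter_atTop (μ := μ) (s := N)
    (fun d => (hNm d).nullMeasurableSet)
    (fun d e hde ω hω i hi hid => hω i hi (hid.trans hde)) ⟨0, measure_ne_top _ _⟩
  have := (ENNReal.tendsto_toReal (measure_ne_top μ _)).comp hlim
  change Tendsto _ _ (𝓝 (μ.real (⋂ d, N d))) at this
  rwa [hzero] at this

/-- Under strong mixing the measure of an atom `{p}` satisfies `μ {p} ^ 2 ∈ {0, μ {p}}`, so an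
atom carries the whole measure. -/
lemma StrongMixing.measureReal_singleton_eq_one {Ω : Type*} [MeasurableSpace Ω]
    [MeasurableSingletonClass Ω] {μ : Measure Ω} [IsFiniteMeasure μ] {T : Ω → Ω}
    (hmix : StrongMixing T μ) {p : Ω} (hp : μ.real {p} ≠ 0) : μ.real {p} = 1 := by
  have h := hmix.tendsto_measureReal (measurableSet_singleton p) (measurableSet_singleton p)
  have hmem : ∀ n : ℕ, μ.real (T^[n] ⁻¹' {p} ∩ {p}) ∈ ({0, μ.real {p}} : Set ℝ) := by
    intro n
    by_cases hn : T^[n] p = p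
    · right
      have : T^[n] ⁻¹' {p} ∩ {p} = {p} := by
        ext ω
        simp only [Set.mem_inter_iff, Set.mem_preimage, Set.mem_singleton_iff,
          and_iff_right_iff_imp]
        rintro rfl
        exact hn
      rw [this]
      rfl
    · left
      have : T^[n] ⁻¹' {p} ∩ {p} = ∅ := by
        ext ω
        simp only [Set.mem_inter_iff, Set.mem_preimage, Set.mem_singleton_iff,
          Set.mem_empty_iff_false, iff_false, not_and]
        rintro h rfl
        exact hn h
      simp [this]
  have hcl : IsClosed ({0, μ.real {p}} : Set ℝ) := (Set.toFinite _).isClosed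
  rcases hcl.mem_of_tendsto h (Eventually.of_forall hmem) with h' | h'
  · exact absurd (mul_self_eq_zero.1 h') hp
  · exact mul_left_cancel₀ hp (by rw [mul_one]; exact h')

/-- A measure concentrated in one point gives every set mass `0` or `1`. -/
lemma shannonEntropy_eq_zero_of_singleton {Ω ι : Type*} [MeasurableSpace Ω]
    [MeasurableSingletonClass Ω] [Fintype ι] {μ : Measure Ω} [IsProbabilityMeasure μ] {p : Ω}
    (hp : μ.real {p} = 1) (P : ι → Set Ω) : shannonEntropy μ P = 0 := by
  rw [shannonEntropy_eq_sum_negMulLog]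
  refine Finset.sum_eq_zero fun a _ => ?_
  by_cases h : p ∈ P a
  · have : μ.real (P a) = 1 := le_antisymm measureReal_le_one
      (hp ▸ measureReal_mono (Set.singleton_subset_iff.2 h))
    simp [this]
  · have h0 : μ.real {p}ᶜ = 0 := by
      rw [probReal_compl_eq_one_sub (measurableSet_singleton p), hp, sub_self]
    have : μ.real (P a) = 0 := le_antisymm
      (h0 ▸ measureReal_mono (Set.subset_compl_singleton_iff.2 h)) measureReal_nonneg
    simp [this]

/-! ### Equidistributed bins -/

lemma continuous_cdf (ν : Measure ℝ) [IsProbabilityMeasure ν] [NullSingletonClass ν] :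
    Continuous (ProbabilityTheory.cdf ν) := by
  refine continuous_iff_continuousAt.2 fun x => ?_
  rw [(ProbabilityTheory.monotone_cdf ν).continuousAt_iff_leftLim_eq_rightLim,
    StieltjesFunction.rightLim_eq]
  refine le_antisymm ((ProbabilityTheory.monotone_cdf ν).leftLim_le le_rfl) ?_
  have := (ProbabilityTheory.cdf ν).measure_singleton x
  rw [ProbabilityTheory.measure_cdf, measure_singleton] at this
  linarith [ENNReal.ofReal_eq_zero.1 this.symm]

/-- The distribution function of an atomless law is uniformly distributed. -/
lemma measureReal_cdf_lt (ν : Measure ℝ) [IsProbabilityMeasure ν] [NullSingletonClass ν] {t : ℝ}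
    (h0 : 0 ≤ t) (h1 : t ≤ 1) : ν.real {x | ProbabilityTheory.cdf ν x < t} = t := by
  have hsurj : ∀ s, 0 < s → s < 1 → ∃ c, ProbabilityTheory.cdf ν c = s := by
    intro s hs0 hs1
    obtain ⟨a, ha⟩ := ((ProbabilityTheory.tendsto_cdf_atBot ν).eventually_lt_const hs0).exists
    obtain ⟨b, hb⟩ := ((ProbabilityTheory.tendsto_cdf_atTop ν).eventually_const_lt hs1).exists
    exact intermediate_value_univ a b (continuous_cdf ν) ⟨ha.le, hb.le⟩
  apply le_antisymm
  · rcases h1.eq_or_lt with rfl | h1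
    · exact measureReal_le_one
    rcases h0.eq_or_lt with rfl | h0
    · have : {x | ProbabilityTheory.cdf ν x < 0} = ∅ := by
        ext x
        simpa using ProbabilityTheory.cdf_nonneg ν x
      simp [this]
    obtain ⟨c, hc⟩ := hsurj t h0 h1
    calc ν.real {x | ProbabilityTheory.cdf ν x < t} ≤ ν.real (Set.Iic c) := by
          refine measureReal_mono fun x hx => ?_
          rw [Set.mem_ofPred_eq, ← hc] at hx
          exact ((ProbabilityTheory.monotone_cdf ν).reflect_lt hx).le
      _ = t := by rw [← ProbabilityTheory.cdf_eq_real, hc]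
  · rcases h0.eq_or_lt with rfl | h0
    · exact measureReal_nonneg
    refine le_of_forall_lt fun s hs => ?_
    obtain ⟨r, hr, hrt⟩ := exists_between (max_lt hs h0)
    rw [max_lt_iff] at hr
    obtain ⟨c, hc⟩ := hsurj r hr.2 (hrt.trans_le h1)
    calc s < r := hr.1
      _ = ν.real (Set.Iic c) := by rw [← ProbabilityTheory.cdf_eq_real, hc]
      _ ≤ _ := measureReal_mono fun x hx =>
        ((ProbabilityTheory.monotone_cdf ν hx).trans_eq hc).trans_lt hrt

/-- The `k`-th bin consists of the points whose value of the distribution function lies in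
`[k/m, (k+1)/m)`. The bin `m` is needed only for the null set where that value is `1`. -/
lemma exists_equidistributed_bins {Ω : Set ℝ} (μ : Measure Ω) [IsProbabilityMeasure μ]
    [NullSingletonClass μ] {m : ℕ} (hm : 0 < m) :
    ∃ b : Ω → ℕ, Measurable b ∧ (∀ ω, b ω ≤ m) ∧ (∀ ω ω', b ω < b ω' → ω < ω') ∧
      (∀ k < m, μ.real (b ⁻¹' {k}) = 1 / m) ∧ μ.real (b ⁻¹' {m}) = 0 := by
  have hm' : (0 : ℝ) < m := by exact_mod_cast hm
  have hval : Measurable (Subtype.val : Ω → ℝ) := measurable_subtype_coe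
  set ν : Measure ℝ := μ.map Subtype.val with hν
  have : IsProbabilityMeasure ν := Measure.isProbabilityMeasure_map hval.aemeasurable
  have : NullSingletonClass ν := ⟨fun x => by
    rw [hν, Measure.map_apply hval (measurableSet_singleton x)]
    exact (Set.subsingleton_singleton.preimage Subtype.val_injective).measure_zero μ⟩
  set F : ℝ → ℝ := fun x => ProbabilityTheory.cdf ν x
  have hFmono : Monotone F := ProbabilityTheory.monotone_cdf ν
  have hF0 : ∀ x, 0 ≤ F x := ProbabilityTheory.cdf_nonneg ν
  have hF1 : ∀ x, F x ≤ 1 := ProbabilityTheory.cdf_le_one ν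
  set b : Ω → ℕ := fun ω => ⌊m * F ω⌋₊ with hb
  have hbm : Measurable b :=
    Nat.measurable_floor.comp ((hFmono.measurable.comp hval).const_mul _)
  have hlt : ∀ k : ℕ, k ≤ m → μ.real {ω | b ω < k} = k / m := by
    intro k hk
    have hset : {ω | b ω < k} = Subtype.val ⁻¹' {x | F x < (k : ℝ) / m} := by
      ext ω
      simp only [hb, Set.mem_ofPred_eq, Set.mem_preimage]
      rw [Nat.floor_lt (mul_nonneg hm'.le (hF0 _)), lt_div_iff₀ hm', mul_comm]
    have hms : MeasurableSet {x | F x < (k : ℝ) / m} :=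
      measurableSet_lt hFmono.measurable measurable_const
    rw [hset, ← map_measureReal_apply hval hms]
    exact measureReal_cdf_lt ν (by positivity)
      ((div_le_one hm').2 (by exact_mod_cast hk))
  have hbin : ∀ k : ℕ, b ⁻¹' {k} = {ω | b ω < k + 1} \ {ω | b ω < k} := by
    intro k
    ext ω
    simp only [Set.mem_preimage, Set.mem_singleton_iff, Set.mem_sdiff, Set.mem_ofPred_eq]
    omega
  have hble : ∀ ω, b ω ≤ m := by
    intro ω
    refine Nat.floor_le_of_le ?_
    calc (m : ℝ) * F ω ≤ m * 1 := by gcongr; exact hF1 _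
      _ = m := mul_one _
  have hmeas : ∀ k : ℕ, MeasurableSet {ω | b ω < k} :=
    fun k => measurableSet_lt hbm measurable_const
  have hdiff : ∀ k : ℕ, μ.real (b ⁻¹' {k}) = μ.real {ω | b ω < k + 1} - μ.real {ω | b ω < k} := by
    intro k
    have hsub : {ω | b ω < k} ⊆ {ω | b ω < k + 1} := fun ω hω => Nat.lt_succ_of_lt hω
    rw [hbin, measureReal_sdiff hsub (hmeas k)]
  refine ⟨b, hbm, hble, ?_, ?_, ?_⟩
  · intro ω ω' h
    by_contra hle
    have h1 : F ω' ≤ F ω := hFmono (Subtype.coe_le_coe.2 (not_lt.1 hle))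
    exact absurd h (not_lt.2 (Nat.floor_le_floor (by gcongr)))
  · intro k hk
    rw [hdiff, hlt k hk.le, hlt (k + 1) hk]
    push_cast
    ring
  · have huniv : {ω | b ω < m + 1} = Set.univ :=
      Set.eq_univ_of_forall fun ω => Nat.lt_succ_of_le (hble ω)
    rw [hdiff, hlt m le_rfl, huniv, probReal_univ, div_self hm'.ne', sub_self]

/-! ### Neighbouring points become rare -/

/-- If `ω` and `T^{d+1} ω` fall into bins that are not adjacent, then almost surely, for large
`d`, some intermediate iterate visits a bin between them. Adjacent bins are hit with asymptotic
probability of order `1 / m` by mixing. -/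
lemma StrongMixing.tendsto_measureReal_neighbourSet {Ω : Set ℝ} {μ : Measure Ω}
    [IsProbabilityMeasure μ] [NullSingletonClass μ] {T : Ω → Ω} (hT : Measurable T)
    (hmix : StrongMixing T μ) :
    Tendsto (fun d : ℕ => μ.real (neighbourSet T (fun ω : Ω => (ω : ℝ)) d)) atTop (𝓝 0) := by
  refine tendsto_order.2 ⟨fun a ha => Eventually.of_forall fun d =>
    ha.trans_le measureReal_nonneg, fun ε hε => ?_⟩
  obtain ⟨m, hm⟩ := exists_nat_gt (3 / ε)
  have hm0 : (0 : ℝ) < m := lt_trans (div_pos three_pos hε) hm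
  have hmε : 3 / (m : ℝ) < ε := (div_lt_comm₀ hε hm0).1 hm
  have hmpos : 0 < m := by exact_mod_cast hm0
  obtain ⟨b, hbm, hble, hblt, hbin, hbinm⟩ := exists_equidistributed_bins μ hmpos
  have hbs : ∀ s : Set ℕ, MeasurableSet (b ⁻¹' s) := fun s => hbm (Set.to_countable s).measurableSet
  set near : ℕ → Set ℕ := fun k => {j | j ≤ k + 1 ∧ k ≤ j + 1} with hnear
  have hbin' : ∀ k, μ.real (b ⁻¹' {k}) ≤ 1 / m := by
    intro k
    rcases lt_trichotomy k m with h | rfl | h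
    · exact (hbin k h).le
    · rw [hbinm]; positivity
    · have : b ⁻¹' {k} = ∅ := by
        ext ω
        have := hble ω
        simp only [Set.mem_preimage, Set.mem_singleton_iff, Set.mem_empty_iff_false, iff_false]
        omega
      rw [this]; simp
  have hnear' : ∀ k, μ.real (b ⁻¹' near k) ≤ 3 / m := by
    intro k
    have hsub : b ⁻¹' near k ⊆ b ⁻¹' {k - 1} ∪ b ⁻¹' {k} ∪ b ⁻¹' {k + 1} := by
      intro ω hω
      simp only [hnear, Set.mem_preimage, Set.mem_ofPred_eq] at hω
      simp only [Set.mem_union, Set.mem_preimage, Set.mem_singleton_iff]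
      omega
    have h1 := measureReal_mono (μ := μ) hsub
    have h2 := measureReal_union_le (μ := μ) (b ⁻¹' {k - 1} ∪ b ⁻¹' {k}) (b ⁻¹' {k + 1})
    have h3 := measureReal_union_le (μ := μ) (b ⁻¹' {k - 1}) (b ⁻¹' {k})
    have : (3 : ℝ) / m = 1 / m + 1 / m + 1 / m := by ring
    linarith [hbin' (k - 1), hbin' k, hbin' (k + 1)]
  set N : ℕ → ℕ → Set Ω := fun k d => {ω | ∀ i, 1 ≤ i → i ≤ d → T^[i] ω ∉ b ⁻¹' {k}} with hN
  have hsub : ∀ d, neighbourSet T (fun ω : Ω => (ω : ℝ)) d ⊆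
      (⋃ k ∈ Finset.range m, N k d) ∪
        ⋃ k ∈ Finset.range (m + 1), T^[d + 1] ⁻¹' (b ⁻¹' near k) ∩ b ⁻¹' {k} := by
    intro d ω hω
    by_contra hcon
    simp only [Set.mem_union, Set.mem_iUnion, Finset.mem_range, not_or, not_exists, hN, hnear,
      Set.mem_ofPred_eq, Set.mem_inter_iff, Set.mem_preimage, Set.mem_singleton_iff,
      not_forall, not_not, not_and] at hcon
    obtain ⟨hvisit, hfar⟩ := hcon
    have hfar := fun h1 h2 => hfar (b ω) (Nat.lt_succ_of_le (hble ω)) ⟨h1, h2⟩ rfl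
    have hl := hble ω
    have hr := hble (T^[d + 1] ω)
    rcases Nat.lt_or_ge (b ω + 1) (b (T^[d + 1] ω)) with h | h
    · obtain ⟨i, hi1, hid, hi⟩ := hvisit (b ω + 1) (by omega)
      exact (hω i hi1 hid).1 ⟨hblt _ _ (by omega), hblt _ _ (by omega)⟩
    · rcases Nat.lt_or_ge (b (T^[d + 1] ω) + 1) (b ω) with h' | h'
      · obtain ⟨i, hi1, hid, hi⟩ := hvisit (b (T^[d + 1] ω) + 1) (by omega)
        exact (hω i hi1 hid).2 ⟨hblt _ _ (by omega), hblt _ _ (by omega)⟩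
      · exact hfar h h'
  have hbound : ∀ d, μ.real (neighbourSet T (fun ω : Ω => (ω : ℝ)) d) ≤
      ∑ k ∈ Finset.range m, μ.real (N k d) +
        ∑ k ∈ Finset.range (m + 1), μ.real (T^[d + 1] ⁻¹' (b ⁻¹' near k) ∩ b ⁻¹' {k}) := by
    intro d
    refine (measureReal_mono (hsub d)).trans ((measureReal_union_le _ _).trans ?_)
    exact add_le_add (measureReal_biUnion_finset_le _ _) (measureReal_biUnion_finset_le _ _)
  have hlim : Tendsto (fun d : ℕ => ∑ k ∈ Finset.range m, μ.real (N k d) +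
      ∑ k ∈ Finset.range (m + 1), μ.real (T^[d + 1] ⁻¹' (b ⁻¹' near k) ∩ b ⁻¹' {k})) atTop
      (𝓝 (∑ _k ∈ Finset.range m, 0 +
        ∑ k ∈ Finset.range (m + 1), μ.real (b ⁻¹' near k) * μ.real (b ⁻¹' {k}))) := by
    refine (tendsto_finsetSum _ fun k hk => ?_).add (tendsto_finsetSum _ fun k _ => ?_)
    · refine hmix.tendsto_measureReal_avoid hT (hbs {k}) ?_
      rw [hbin k (Finset.mem_range.1 hk)]
      positivity
    · exact (hmix.tendsto_measureReal (hbs _) (hbs _)).comp (tendsto_add_atTop_nat 1)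
  have hsum : ∑ _k ∈ Finset.range m, (0 : ℝ) +
      ∑ k ∈ Finset.range (m + 1), μ.real (b ⁻¹' near k) * μ.real (b ⁻¹' {k}) < ε := by
    refine lt_of_le_of_lt ?_ hmε
    rw [Finset.sum_const_zero, zero_add]
    calc ∑ k ∈ Finset.range (m + 1), μ.real (b ⁻¹' near k) * μ.real (b ⁻¹' {k})
        ≤ ∑ k ∈ Finset.range (m + 1), 3 / (m : ℝ) * μ.real (b ⁻¹' {k}) :=
          Finset.sum_le_sum fun k _ =>
            mul_le_mul_of_nonneg_right (hnear' k) measureReal_nonneg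
      _ = 3 / (m : ℝ) := by
          rw [← Finset.mul_sum, Finset.sum_range_succ, hbinm,
            Finset.sum_congr rfl fun k hk => hbin k (Finset.mem_range.1 hk)]
          simp [hm0.ne']
  filter_upwards [hlim.eventually_lt_const hsum] with d hd
  exact (hbound d).trans_lt hd

end OrdinalEntropy

end

theorem mainTheorem9 (Ω : Set ℝ) (hΩ : Ω.OrdConnected)
    (μ : MeasureTheory.Measure Ω) [MeasureTheory.IsProbabilityMeasure μ]
    (T : Ω → Ω) (hT : MeasureTheory.MeasurePreserving T μ μ)
    (hmix : OrdinalEntropy.StrongMixing T μ) :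
    Filter.Tendsto
      (fun d : ℕ =>
        OrdinalEntropy.sortingEntropy μ T (OrdinalEntropy.idObservable Ω) d -
          OrdinalEntropy.conditionalEntropy μ T (OrdinalEntropy.idObservable Ω) d)
      Filter.atTop (nhds 0) := by
  by_cases hatom : ∃ p, μ.real {p} ≠ 0
  · obtain ⟨p, hp⟩ := hatom
    have hp1 := hmix.measureReal_singleton_eq_one hp
    simp [OrdinalEntropy.sortingEntropy, OrdinalEntropy.conditionalEntropy,
      OrdinalEntropy.shannonEntropy_eq_zero_of_singleton hp1]
  · push Not at hatom
    have : NullSingletonClass μ := ⟨fun p =>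
      (measureReal_eq_zero_iff (measure_ne_top μ _)).1 (hatom p)⟩
    have hX : Measurable (OrdinalEntropy.idObservable Ω 0) := measurable_subtype_coe
    have hbounds := OrdinalEntropy.sortingEntropy_sub_conditionalEntropy_bounds
      (μ := μ) hT.measurable hX
    refine squeeze_zero (fun d => (hbounds d).1) (fun d => (hbounds d).2) ?_
    have h := (hmix.tendsto_measureReal_neighbourSet hT.measurable).const_mul (Real.log 2)
    rwa [mul_zero] at h
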